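/- Let $\mathbb N=\{1,2,3,\dots\}$ and $\omega=\mathbb N\cup\{0\}$. For $i,j\in\omega$ let $a_{i,j}=2$ if $j=i$, $a_{i,j}=1$ if $2^i\le j<2^{i+1}$, and $a_{i,j}=0$ otherwise; let $A=(a_{i,j})_{i,j\in\omega}$ and let $I$ be the $\omega\times\omega$ identity matrix. Then $\begin{pmatrix}A&-I\end{pmatrix}$ has only finitely many nonzero entries in each row, and it is the coefficient matrix of the system $$2x_n+x_{2^n}+x_{2^n+1}+\cdots+x_{2^{n+1}-1}=y_n,\qquad n\in\omega,$$ in the sense that $\begin{pmatrix}A&-I\end{pmatrix}\begin{pmatrix}\vec x\\ \vec y\end{pmatrix}=\vec 0$ holds exactly when all these equations hold, for all $\vec x,\vec y\in\mathbb N^\omega$. A subset $C$ of $\mathbb N$ is *central* if it is a member of some idempotent $p=p+p$ of $\beta\mathbb N$ lying in the smallest two-sided ideal $K(\beta\mathbb N)$, where $\beta\mathbb N$ is the semigroup of ultrafilters on $\mathbb N$ with $B\in p+q$ if and only if $\{x\in\mathbb N:\{y\in\mathbb N:x+y\in B\}\in q\}\in p$. A rational matrix $M$ with finitely many nonzero entries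 in each row is *partition regular over $\mathbb N$* if for every $k\in\mathbb N$ and every $c:\mathbb N\to\{1,\dots,k\}$ there is a vector $\vec z$ with entries in $\mathbb N$, all of the same colour under $c$, such that $M\vec z=\vec 0$. Such a matrix $M$, with columns $\vec c_i$, has the *columns property* if its column index set has a partition $\langle I_t\rangle_{t<\mu}$ into nonempty sets, with $\mu\in\mathbb N\cup\{\omega\}$, such that $\sum_{i\in I_0}\vec c_i=\vec 0$ and, for each $0<t<\mu$, $\sum_{i\in I_t}\vec c_i$ is a linear combination with rational coefficients of $\{\vec c_i:i\in\bigcup_{s<t}I_s\}$ (sums and linear combinations may be infinite; they make sense row by row). Then: 1. No nonempty (finite or infinite) set of columns of $\begin{pmatrix}A&-I\end{pmatrix}$ sums to $\vec 0$. 2. For every central subset $C$ of $\mathbb N$ there exist $\vec x,\vec y\in C^\omega$ such that $\begin{pmatrix}A&-I\end{pmatrix}\begin{pmatrix}\vec x\\ \vec y\end{pmatrix}=\vec 0$. 3. Consequently the system is partition regular over $\mathbb N$. 4. $\begin{pmatrix}A&-I\end{pmatrix}$ does not have the columns property. -/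

import Mathlib

namespace InfiniteRado

section Central

/-- A two-sided ideal of an (additively written) semigroup: a nonempty subset that absorbs
addition on either side. -/
def IsTwoSidedIdeal {T : Type*} [Add T] (J : Set T) : Prop :=
  J.Nonempty ∧ ∀ t : T, ∀ a ∈ J, t + a ∈ J ∧ a + t ∈ J

/-- `K(T)`, the smallest two-sided ideal of `T` (as the intersection of all two-sided ideals). -/
def smallestIdeal (T : Type*) [Add T] : Set T :=
  ⋂₀ {J : Set T | IsTwoSidedIdeal J}

-- `βS` is `Ultrafilter S`, where `A ∈ p + q` iff `{x | {y | x + y ∈ A} ∈ q} ∈ p`.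
attribute [local instance] Ultrafilter.addSemigroup

/-- `C ⊆ S` is central if it is a member of some idempotent of `βS` that lies in the smallest
two-sided ideal `K(βS)`. -/
def IsCentral {S : Type*} [AddSemigroup S] (C : Set S) : Prop :=
  ∃ p : Ultrafilter S, p + p = p ∧ p ∈ smallestIdeal (Ultrafilter S) ∧ C ∈ p

end Central

section Matrices

/-- Each row has only finitely many nonzero entries (standing assumption on infinite matrices;
all the sums below are then finite sums in each row). -/
def RowFinite {κ ι : Type*} (A : Matrix κ ι ℚ) : Prop :=
  ∀ i, {j | A i j ≠ 0}.Finite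

/-- The vector `x` of positive integers satisfies `A x = 0`. -/
def IsSolution {κ ι : Type*} (A : Matrix κ ι ℚ) (x : ι → ℕ+) : Prop :=
  ∀ i, ∑ᶠ j, A i j * ((x j : ℕ) : ℚ) = 0

/-- `A` is (kernel) partition regular over the positive integers. -/
def IsPartitionRegular {κ ι : Type*} (A : Matrix κ ι ℚ) : Prop :=
  ∀ k : ℕ, 0 < k → ∀ c : ℕ+ → Fin k,
    ∃ x : ι → ℕ+, (∀ j j', c (x j) = c (x j')) ∧ IsSolution A x

/-- The (possibly infinite) sum of the columns of `A` with index in `J`. -/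
noncomputable def columnSum {κ ι : Type*} (A : Matrix κ ι ℚ) (J : Set ι) : κ → ℚ :=
  fun i => ∑ᶠ j ∈ J, A i j

/-- The columns property of a row-finite matrix: the columns can be partitioned into nonempty
blocks `I t`, `t < μ`, with `1 ≤ μ ≤ ω`, such that the columns in `I 0` sum to zero and, for
`0 < t < μ`, the sum of the columns in `I t` is a (possibly infinite) rational linear
combination of the columns in the earlier blocks. -/
def HasColumnsProperty {κ ι : Type*} (A : Matrix κ ι ℚ) : Prop :=
  ∃ (μ : ℕ∞) (I : ℕ → Set ι), 0 < μ ∧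
    (∀ t : ℕ, (t : ℕ∞) < μ → (I t).Nonempty) ∧
    (∀ j, ∃! t : ℕ, (t : ℕ∞) < μ ∧ j ∈ I t) ∧
    columnSum A (I 0) = 0 ∧
    ∀ t : ℕ, 0 < t → (t : ℕ∞) < μ →
      ∃ d : ι → ℚ, ∀ i, columnSum A (I t) i = ∑ᶠ j ∈ ⋃ s < t, I s, d j * A i j

/-- The `ω × ω` matrix `A` with entry `2` at `(i, i)`, entry `1` at `(i, j)` for
`2 ^ i ≤ j < 2 ^ (i + 1)`, and `0` elsewhere. -/
def matA : Matrix ℕ ℕ ℚ := fun i j =>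
  if j = i then 2 else if 2 ^ i ≤ j ∧ j < 2 ^ (i + 1) then 1 else 0

/-- The coefficient matrix `(A  -I)`; the columns `Sum.inl j` belong to the unknowns `x_j` and
the columns `Sum.inr j` to the unknowns `y_j`. -/
def coeffMatrix : Matrix ℕ (ℕ ⊕ ℕ) ℚ := Matrix.fromCols matA (-1)

end Matrices

end InfiniteRado

/-!
The unknowns `x j` form a tree with root `x 0`: `x j` with `2 ^ n ≤ j < 2 ^ (n + 1)` is a child of
`x n` and occurs, apart from its own equation `j`, only in equation `n`. The system can therefore
be solved from `x 0` on, provided that each `x n` is chosen among the elements `x` for which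
`2 ^ n` children `z` and an element `y = 2 * x + ∑ z` can be found in the given central set `C`.

Let `p` be an idempotent in `K(βℕ)` with `C ∈ p`. Since `p` lies in a minimal left ideal, the set
`R` of all `d` with `-d + C ∈ p` is syndetic (`LeftMinimal.exists_finite_add_mem_returnSet`). This is
used in two ways.

* For one fixed number of children, `p`-almost every `x` has children in any prescribed member of
  `p` (`eventually_hasChildren`): pigeonhole on the translates of `R` yields a pair `z`, `z + 2 * x`,
  and further children are absorbed by idempotence.
* If the number of children is large, then every `x ∈ C` divisible by the gcd of `R` has children,
  with a bound independent of `x` (`exists_uniform_hasChildren`), because sums of many elements of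
  `R` fill up long progressions.

The second fact settles all but finitely many equations; the remaining ones are met by shrinking
the set finitely often with the first fact (`exists_antitone_hasChildren`). Every finite colouring
has a central colour class, which gives partition regularity. No set of columns sums to zero, by
comparing the `2` on the diagonal of `A` with the single `-1` in each row, and this excludes the
columns property at its first block.
-/

namespace InfiniteRado

attribute [local instance] Ultrafilter.add Ultrafilter.addSemigroup

/-! ### The smallest ideal of `βS` and syndetic return sets -/

section SmallestIdeal

variable {S : Type*} [AddSemigroup S]

/-- The ultrafilters `r` that belong to a minimal left ideal of `βS`: `r` can be recovered from
`q + r`, for every `q`, by adding an ultrafilter on the left. -/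
def LeftMinimal (r : Ultrafilter S) : Prop :=
  ∀ q : Ultrafilter S, ∃ s : Ultrafilter S, s + (q + r) = r

/-- A minimal nonempty closed left ideal of `βS` consists of `LeftMinimal` ultrafilters, because
`βS + (q + r)` is a closed left ideal inside it whenever `r` is one of its points. -/
theorem exists_closed_leftIdeal_leftMinimal [Nonempty S] :
    ∃ L : Set (Ultrafilter S), IsClosed L ∧ L.Nonempty ∧
      (∀ t, ∀ a ∈ L, t + a ∈ L) ∧ ∀ r ∈ L, LeftMinimal r := by
  let T : Set (Set (Ultrafilter S)) :=
    {N | IsClosed N ∧ N.Nonempty ∧ ∀ t, ∀ a ∈ N, t + a ∈ N}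
  obtain ⟨L, hL⟩ : ∃ L, Minimal (· ∈ T) L := by
    refine zorn_superset _ fun c hcs hc => ?_
    refine ⟨⋂₀ c, ⟨isClosed_sInter fun t ht => (hcs ht).1, ?_, fun t a ha => ?_⟩,
      fun s hs => Set.sInter_subset_of_mem hs⟩
    · obtain rfl | hcnemp := c.eq_empty_or_nonempty
      · rw [Set.sInter_empty]
        exact ⟨pure (Classical.arbitrary S), trivial⟩
      · rw [Set.sInter_eq_iInter]
        have := hcnemp.coe_sort
        exact IsCompact.nonempty_iInter_of_directed_nonempty_isCompact_isClosed _
          (DirectedOn.directed_val (IsChain.directedOn hc.symm)) (fun i => (hcs i.prop).2.1)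
          (fun i => (hcs i.prop).1.isCompact) (fun i => (hcs i.prop).1)
    · exact fun s hs => (hcs hs).2.2 t a (ha s hs)
  obtain ⟨hcl, hne, hadd⟩ := hL.prop
  refine ⟨L, hcl, hne, hadd, fun r hr q => ?_⟩
  have hrange : Set.range (fun s : Ultrafilter S => s + (q + r)) = L := by
    apply hL.eq_of_subset
    · refine ⟨(isCompact_range (Ultrafilter.continuous_add_left (q + r))).isClosed,
        ⟨_, ⟨q, rfl⟩⟩, ?_⟩
      rintro t _ ⟨s, rfl⟩
      exact ⟨t + s, add_assoc _ _ _⟩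
    · rintro _ ⟨s, rfl⟩
      exact hadd s _ (hadd q r hr)
  rw [← hrange] at hr
  exact hr

theorem LeftMinimal.mem_smallestIdeal {r : Ultrafilter S} (hr : LeftMinimal r) :
    r ∈ smallestIdeal (Ultrafilter S) := by
  rintro J ⟨⟨a, ha⟩, hJ⟩
  obtain ⟨s, hs⟩ := hr a
  rw [← hs]
  exact (hJ s _ (hJ r a ha).2).1

/-- The `LeftMinimal` ultrafilters form a two-sided ideal, so `K(βS)` is contained in it. -/
theorem leftMinimal_of_mem_smallestIdeal [Nonempty S] {p : Ultrafilter S}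
    (hp : p ∈ smallestIdeal (Ultrafilter S)) : LeftMinimal p := by
  obtain ⟨L, -, ⟨r, hr⟩, -, hL⟩ := exists_closed_leftIdeal_leftMinimal (S := S)
  refine Set.mem_sInter.1 hp {r | LeftMinimal r} ⟨⟨r, hL r hr⟩, fun t a ha => ⟨fun q => ?_,
    fun q => ?_⟩⟩
  · obtain ⟨s, hs⟩ := ha (q + t)
    exact ⟨t + s, by rw [← add_assoc q, add_assoc, hs]⟩
  · obtain ⟨s, hs⟩ := ha q
    exact ⟨s, by rw [← add_assoc q, ← add_assoc, hs]⟩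

theorem exists_idempotent_mem_smallestIdeal [Nonempty S] :
    ∃ p : Ultrafilter S, p + p = p ∧ p ∈ smallestIdeal (Ultrafilter S) := by
  obtain ⟨L, hcl, hne, hadd, hL⟩ := exists_closed_leftIdeal_leftMinimal (S := S)
  obtain ⟨p, hp, hpp⟩ := exists_idempotent_in_compact_add_subsemigroup
    Ultrafilter.continuous_add_left L hne hcl.isCompact fun x _ y hy => hadd x y hy
  exact ⟨p, hpp, (hL p hp).mem_smallestIdeal⟩

/-- The set of `d` for which the translate `-d + C` is a member of `p`. -/
def returnSet (p : Ultrafilter S) (C : Set S) : Set S :=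
  {d | ∀ᶠ n in p, d + n ∈ C}

theorem returnSet_mem {p : Ultrafilter S} (hpp : p + p = p) {C : Set S} (hC : C ∈ p) :
    returnSet p C ∈ p := by
  have h : ∀ᶠ n in (p + p : Ultrafilter S), n ∈ C := by rw [hpp]; exact hC
  exact (Ultrafilter.eventually_add _ _ _).1 h

/-- Members of a `LeftMinimal` ultrafilter return syndetically: finitely many translates of
`returnSet p C` cover `S`. By minimality every ultrafilter contains such a translate, and `βS` is
compact. -/
theorem LeftMinimal.exists_finite_add_mem_returnSet {p : Ultrafilter S} (hp : LeftMinimal p)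
    {C : Set S} (hC : C ∈ p) :
    ∃ G : Finset S, ∀ v, ∃ g ∈ G, g + v ∈ returnSet p C := by
  obtain ⟨G, hG⟩ := isCompact_univ.elim_finite_subcover
    (fun g : S => {q : Ultrafilter S | {v | g + v ∈ returnSet p C} ∈ q})
    (fun g => ultrafilter_isOpen_basic _) (by
      intro q _
      obtain ⟨s, hs⟩ := hp q
      have h : ∀ᶠ n in (s + (q + p) : Ultrafilter S), n ∈ C := by rw [hs]; exact hC
      obtain ⟨g, hg⟩ := ((Ultrafilter.eventually_add _ _ _).1 h).exists
      rw [Ultrafilter.eventually_add] at hg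
      refine Set.mem_iUnion.2 ⟨g, ?_⟩
      filter_upwards [hg] with v hv
      filter_upwards [hv] with n hn
      rwa [add_assoc])
  refine ⟨G, fun v => ?_⟩
  have := hG (Set.mem_univ (pure v : Ultrafilter S))
  simpa using this

end SmallestIdeal

/-! ### Solving the system inside a central set -/

section PositiveIntegers

theorem eventually_dvd_of_idempotent {p : Ultrafilter ℕ+} (hpp : p + p = p) {m : ℕ}
    (hm : m ≠ 0) : ∀ᶠ n : ℕ+ in p, m ∣ (n : ℕ) := by
  have : NeZero m := ⟨hm⟩
  obtain ⟨a, ha⟩ := (p.map fun n : ℕ+ => ((n : ℕ) : ZMod m)).eq_pure_of_finite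
  have h1 : ∀ᶠ n : ℕ+ in p, ((n : ℕ) : ZMod m) = a := by
    have : {a} ∈ p.map fun n : ℕ+ => ((n : ℕ) : ZMod m) := by rw [ha]; exact Set.mem_singleton a
    exact this
  have h2 : ∀ᶠ n : ℕ+ in (p + p : Ultrafilter ℕ+), ((n : ℕ) : ZMod m) = a := by rwa [hpp]
  rw [Ultrafilter.eventually_add] at h2
  obtain ⟨x, hx, hx2⟩ := (h1.and h2).exists
  obtain ⟨y, hy, hxy⟩ := (h1.and hx2).exists
  have ha0 : a = 0 := by
    rw [PNat.add_coe, Nat.cast_add, hx, hy] at hxy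
    simpa using hxy
  filter_upwards [h1] with n hn
  rwa [ha0, ZMod.natCast_eq_zero_iff] at hn

/-- `x` has `k` children in `B`, with repetition allowed, such that twice `x` plus the sum of the
children lies in `C`. The sequence `z` is indexed by `ℕ`, but only its first `k` terms enter the
sum. -/
def HasChildren (k : ℕ) (B C : Set ℕ+) (x : ℕ+) : Prop :=
  ∃ z : ℕ → ℕ+, (∀ i, z i ∈ B) ∧ ∃ y ∈ C, 2 * (x : ℕ) + ∑ i ∈ Finset.range k, (z i : ℕ) = y

theorem sum_range_succ_ite_eq (k : ℕ) (w : ℕ → ℕ+) (n : ℕ+) :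
    ∑ i ∈ Finset.range (k + 1), ((if i = k then n else w i : ℕ+) : ℕ) =
      ∑ i ∈ Finset.range k, (w i : ℕ) + n := by
  rw [Finset.sum_range_succ, if_pos rfl]
  congr 1
  exact Finset.sum_congr rfl fun i hi => by rw [if_neg (Finset.mem_range.1 hi).ne]

/-- The pairs at distance `2 * x` inside `B` are found by pigeonhole: finitely many translates of
the return set cover `ℕ+`, so some translate is hit by `2 * e` and by `2 * (e + x)` for one `e` and
`p`-almost all `x`. -/
theorem eventually_exists_add_two_mul_mem {p : Ultrafilter ℕ+} (hpp : p + p = p)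
    (hmin : LeftMinimal p) {B : Set ℕ+} (hB : B ∈ p) :
    ∀ᶠ x in p, ∃ z ∈ B, x + x + z ∈ B := by
  obtain ⟨G, hG⟩ := hmin.exists_finite_add_mem_returnSet hB
  obtain ⟨g, -, hg⟩ : ∃ g ∈ G, ∀ᶠ x in p, g + (x + x) ∈ returnSet p B :=
    (Ultrafilter.eventually_exists_mem_iff G.finite_toSet).1
      (Filter.Eventually.of_forall fun x => hG (x + x))
  have h2 : ∀ᶠ x in (p + p : Ultrafilter ℕ+), g + (x + x) ∈ returnSet p B := by rwa [hpp]
  rw [Ultrafilter.eventually_add] at h2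
  obtain ⟨e, he, he2⟩ := (hg.and h2).exists
  filter_upwards [he2] with x hx
  obtain ⟨n, hn1, hn2⟩ := (he.and hx).exists
  refine ⟨_, hn1, ?_⟩
  convert hn2 using 1
  ring

/-- For a fixed number `k + 1` of children, `p`-almost every `x` has children in `B`. A pair
`z, x + x + z` is taken inside `B ∩ returnSet p B`, which allows further children to be added one
at a time without leaving this set. -/
theorem eventually_hasChildren {p : Ultrafilter ℕ+} (hpp : p + p = p)
    (hmin : LeftMinimal p) {B : Set ℕ+} (hB : B ∈ p) (k : ℕ) :
    ∀ᶠ x in p, HasChildren (k + 1) B B x := by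
  have hstar : B ∩ returnSet p B ∈ p := Filter.inter_mem hB (returnSet_mem hpp hB)
  filter_upwards [eventually_exists_add_two_mul_mem hpp hmin hstar] with x hx
  obtain ⟨z, hz, hxz⟩ := hx
  suffices h : HasChildren (k + 1) B (B ∩ returnSet p B) x by
    obtain ⟨z, hz, y, hy, h⟩ := h
    exact ⟨z, hz, y, hy.1, h⟩
  induction k with
  | zero => exact ⟨fun _ => z, fun _ => hz.1, _, hxz, by simp; ring⟩
  | succ k ih =>
    obtain ⟨w, hw, y, ⟨hyB, hyR⟩, hy⟩ := ih
    have hyR2 : ∀ᶠ n in p, y + n ∈ returnSet p B := by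
      have h : ∀ᶠ n in (p + p : Ultrafilter ℕ+), y + n ∈ B := by rw [hpp]; exact hyR
      rw [Ultrafilter.eventually_add] at h
      filter_upwards [h] with a ha
      filter_upwards [ha] with b hb
      rwa [add_assoc]
    obtain ⟨n, hnB, hyn, hynR⟩ := ((show ∀ᶠ n in p, n ∈ B from hB).and (hyR.and hyR2)).exists
    refine ⟨fun i => if i = k + 1 then n else w i, fun i => ?_, y + n, ⟨hyn, hynR⟩, ?_⟩
    · dsimp only
      split_ifs
      exacts [hnB, hw i]
    · rw [sum_range_succ_ite_eq, ← add_assoc, hy, PNat.add_coe]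

/-- An element `u` of the monoid generated by a set of positive integers is a sum of at most `u`
generators; the sum is padded with zeros to any prescribed length `k ≥ u`. -/
theorem exists_sum_range_eq_of_mem_closure {s : Set ℕ} (hs : ∀ a ∈ s, 0 < a) {u : ℕ}
    (hu : u ∈ AddSubmonoid.closure s) :
    ∀ k, u ≤ k → ∃ f : ℕ → ℕ, (∀ i, f i = 0 ∨ f i ∈ s ∧ f i ≤ u) ∧
      ∑ i ∈ Finset.range k, f i = u := by
  induction hu using AddSubmonoid.closure_induction_left with
  | zero => exact fun k _ => ⟨fun _ => 0, fun _ => Or.inl rfl, by simp⟩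
  | add_left a ha b _ ih =>
    intro k hk
    have := hs a ha
    obtain ⟨k, rfl⟩ : ∃ k', k = k' + 1 := ⟨k - 1, by omega⟩
    obtain ⟨f, hf, hsum⟩ := ih k (by omega)
    refine ⟨fun i => Nat.casesOn i a f, fun i => ?_, ?_⟩
    · cases i with
      | zero => exact Or.inr ⟨ha, Nat.le_add_right _ _⟩
      | succ i => exact (hf i).imp_right fun h => ⟨h.1, h.2.trans (Nat.le_add_left _ _)⟩
    · rw [Finset.sum_range_succ', add_comm]
      exact congrArg (a + ·) hsum

/-- For a large number of children no genericity of `x` is needed: the members of a suitable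
`D ⊆ C` in `p` all have children in `D`.

`D` consists of the elements of `C` divisible by the gcd `m` of the return set of `C`. The
monoid generated by the return set contains every large multiple of `m`, so sums `(N + f 0) + ⋯ + (N + f (k - 2))`
with `f i` in the return set or zero cover a long stretch of a progression of difference `m`, and
`2 * x` plus such a sum hits the syndetic return set. One last child then completes the sum to an
element of `C`. -/
theorem exists_uniform_hasChildren {p : Ultrafilter ℕ+} (hpp : p + p = p)
    (hmin : LeftMinimal p) {C : Set ℕ+} (hC : C ∈ p) :
    ∃ D ∈ p, D ⊆ C ∧ ∃ K : ℕ, ∀ k ≥ K, ∀ x ∈ D, HasChildren k D C x := by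
  let R := returnSet p C
  let s : Set ℕ := (fun d : ℕ+ => (d : ℕ)) '' R
  let m := Nat.setGcd s
  have hm : m ≠ 0 := by
    obtain ⟨d, hd⟩ := p.nonempty_of_mem (returnSet_mem hpp hC)
    intro h
    exact d.ne_zero (Nat.setGcd_eq_zero_iff.1 h ⟨d, hd, rfl⟩)
  obtain ⟨u₀, hu₀⟩ := Nat.exists_mem_closure_of_ge s
  obtain ⟨G, hG⟩ := hmin.exists_finite_add_mem_returnSet hC
  let b := ∑ g ∈ G, (g : ℕ)
  have hD : ∀ᶠ n in p, n ∈ C ∧ m ∣ (n : ℕ) :=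
    Filter.Eventually.and hC (eventually_dvd_of_idempotent hpp hm)
  refine ⟨{n | n ∈ C ∧ m ∣ (n : ℕ)}, hD, fun n hn => hn.1, u₀ + b + 1, ?_⟩
  rintro k hk x ⟨-, hmx⟩
  obtain ⟨k, rfl⟩ : ∃ k', k = k' + 1 := ⟨k - 1, by omega⟩
  -- A base point `N` whose translates by all return times up to `u₀ + b` stay in `C`.
  have hN : ∀ᶠ n in p, ∀ d ∈ {d : ℕ+ | (d : ℕ) ≤ u₀ + b}, d ∈ R → d + n ∈ C := by
    have hfin : {d : ℕ+ | (d : ℕ) ≤ u₀ + b}.Finite :=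
      (Set.finite_Iic (u₀ + b)).preimage PNat.coe_injective.injOn
    refine (Filter.eventually_all_finite hfin).2 fun d _ => ?_
    by_cases hd : d ∈ R
    · filter_upwards [hd] with n hn _ using hn
    · exact Filter.Eventually.of_forall fun n h => absurd h hd
  obtain ⟨N, ⟨hNC, hmN⟩, hNR⟩ := (hD.and hN).exists
  -- The return time `d` and the prescribed value `u` of the sum of the `f i`.
  obtain ⟨v, hv⟩ : ∃ v : ℕ+, (v : ℕ) = 2 * x + k * N + u₀ :=
    ⟨⟨2 * x + k * N + u₀, by positivity⟩, rfl⟩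
  obtain ⟨g, hgG, hd⟩ := hG v
  have hgb : (g : ℕ) ≤ b := Finset.single_le_sum (f := fun g : ℕ+ => (g : ℕ))
    (fun _ _ => Nat.zero_le _) hgG
  have hmd := Nat.setGcd_dvd_of_mem (s := s) ⟨_, hd, rfl⟩
  have hmu : m ∣ u₀ + g := by
    have h1 : m ∣ 2 * x + k * N := dvd_add (hmx.mul_left 2) (hmN.mul_left k)
    refine (Nat.dvd_add_right h1).1 (hmd.trans (dvd_of_eq ?_))
    simp only [PNat.add_coe, hv]
    ring
  obtain ⟨f, hf, hsum⟩ := exists_sum_range_eq_of_mem_closure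
    (by rintro _ ⟨d, -, rfl⟩; exact d.pos) (hu₀ (u₀ + g) (Nat.le_add_right _ _) hmu) k (by omega)
  obtain ⟨M, ⟨hMC, hmM⟩, hdM⟩ := (hD.and hd).exists
  choose w hw using fun i => (⟨⟨f i + N, by positivity⟩, rfl⟩ : ∃ w : ℕ+, (w : ℕ) = f i + N)
  have hwD : ∀ i, w i ∈ C ∧ m ∣ (w i : ℕ) := by
    intro i
    rcases hf i with h0 | ⟨⟨d, hdR, hdf⟩, hle⟩
    · have : w i = N := PNat.eq (by rw [hw, h0, zero_add])
      rw [this]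
      exact ⟨hNC, hmN⟩
    · replace hdf : (d : ℕ) = f i := hdf
      have : w i = d + N := PNat.eq (by rw [hw, PNat.add_coe, hdf])
      rw [this, PNat.add_coe]
      refine ⟨hNR d ?_ hdR, dvd_add (Nat.setGcd_dvd_of_mem ⟨d, hdR, rfl⟩) hmN⟩
      rw [Set.mem_ofPred_eq]
      omega
  refine ⟨fun i => if i = k then M else w i, fun i => ?_, _, hdM, ?_⟩
  · dsimp only
    split_ifs
    exacts [⟨hMC, hmM⟩, hwD i]
  · rw [sum_range_succ_ite_eq]
    simp only [hw, Finset.sum_add_distrib, hsum, Finset.sum_const, Finset.card_range, smul_eq_mul,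
      PNat.add_coe, hv]
    ring

/-- Decreasing members of `p`, each point of `X (i + 1)` having any number `1 ≤ k ≤ K` of children
in `X i`. -/
theorem exists_antitone_hasChildren {p : Ultrafilter ℕ+} (hpp : p + p = p)
    (hmin : LeftMinimal p) {D : Set ℕ+} (hD : D ∈ p) (K : ℕ) :
    ∃ X : ℕ → Set ℕ+, X 0 = D ∧ Antitone X ∧ (∀ i, X i ∈ p) ∧
      ∀ i, ∀ k < K, ∀ x ∈ X (i + 1), HasChildren (k + 1) (X i) (X i) x := by
  let step : Set ℕ+ → Set ℕ+ := fun B => {x | x ∈ B ∧ ∀ k < K, HasChildren (k + 1) B B x}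
  refine ⟨fun i => step^[i] D, rfl, antitone_nat_of_succ_le fun i => ?_, fun i => ?_,
    fun i k hk x hx => ?_⟩
  · rw [Function.iterate_succ_apply']
    exact fun x hx => hx.1
  · induction i with
    | zero => exact hD
    | succ i ih =>
      dsimp only
      rw [Function.iterate_succ_apply']
      exact Filter.Eventually.and ih ((Filter.eventually_all_finite (Set.finite_lt_nat K)).2
        fun k _ => eventually_hasChildren hpp hmin ih k)
  · dsimp only at hx
    rw [Function.iterate_succ_apply'] at hx
    exact hx.2 k hk

/-- The sequence with first term `b` in which the block `2 ^ n ≤ j < 2 ^ (n + 1)` is the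
list of children `F n (x n)` chosen for the term `x n`. -/
def treeSeq (F : ℕ → ℕ+ → ℕ → ℕ+) (b : ℕ+) : ℕ → ℕ+
  | 0 => b
  | j + 1 => F (Nat.log 2 (j + 1)) (treeSeq F b (Nat.log 2 (j + 1))) (j + 1)
decreasing_by exact Nat.log_lt_self 2 (Nat.succ_ne_zero j)

theorem treeSeq_of_mem_Ico (F : ℕ → ℕ+ → ℕ → ℕ+) (b : ℕ+) {n j : ℕ}
    (hj : j ∈ Finset.Ico (2 ^ n) (2 ^ (n + 1))) :
    treeSeq F b j = F n (treeSeq F b n) j := by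
  rw [Finset.mem_Ico] at hj
  have hlog := Nat.log_eq_of_pow_le_of_lt_pow hj.1 hj.2
  obtain ⟨j, rfl⟩ : ∃ i, j = i + 1 := ⟨j - 1, by have := Nat.one_le_two_pow (n := n); omega⟩
  rw [treeSeq, hlog]

theorem mem_Ico_two_pow_log {j : ℕ} (hj : j ≠ 0) :
    j ∈ Finset.Ico (2 ^ Nat.log 2 j) (2 ^ (Nat.log 2 j + 1)) :=
  Finset.mem_Ico.2 ⟨Nat.pow_log_le_self 2 hj, Nat.lt_pow_succ_log_self one_lt_two j⟩

/-- If every point of `B n` has a block of children in the sets `B j` completing the `n`-th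
equation inside `C`, then all equations are solved simultaneously, since each unknown other than
`x 0` is a child of exactly one earlier unknown. -/
theorem exists_solution_of_children {C : Set ℕ+} {B : ℕ → Set ℕ+} {b : ℕ+} (hb : b ∈ B 0)
    (H : ∀ n, ∀ x ∈ B n, ∃ z : ℕ → ℕ+,
      (∀ j ∈ Finset.Ico (2 ^ n) (2 ^ (n + 1)), z j ∈ B j) ∧
      ∃ y ∈ C, 2 * (x : ℕ) + ∑ j ∈ Finset.Ico (2 ^ n) (2 ^ (n + 1)), (z j : ℕ) = y) :
    ∃ x y : ℕ → ℕ+, (∀ n, x n ∈ B n) ∧ (∀ n, y n ∈ C) ∧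
      ∀ n, 2 * (x n : ℕ) + ∑ j ∈ Finset.Ico (2 ^ n) (2 ^ (n + 1)), (x j : ℕ) = y n := by
  have H' : ∀ n x, ∃ z : ℕ → ℕ+, x ∈ B n →
      (∀ j ∈ Finset.Ico (2 ^ n) (2 ^ (n + 1)), z j ∈ B j) ∧
      ∃ y ∈ C, 2 * (x : ℕ) + ∑ j ∈ Finset.Ico (2 ^ n) (2 ^ (n + 1)), (z j : ℕ) = y := by
    intro n x
    by_cases hx : x ∈ B n
    · obtain ⟨z, hz⟩ := H n x hx
      exact ⟨z, fun _ => hz⟩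
    · exact ⟨fun _ => 1, fun h => absurd h hx⟩
  choose F hF using H'
  have hmem : ∀ j, treeSeq F b j ∈ B j := by
    intro j
    induction j using Nat.strong_induction_on with
    | _ j ih =>
      rcases eq_or_ne j 0 with rfl | hj
      · rwa [treeSeq]
      · rw [treeSeq_of_mem_Ico F b (mem_Ico_two_pow_log hj)]
        exact (hF _ _ (ih _ (Nat.log_lt_self 2 hj))).1 j (mem_Ico_two_pow_log hj)
  choose y hyC hy using fun n => (hF n _ (hmem n)).2
  refine ⟨treeSeq F b, y, hmem, hyC, fun n => ?_⟩
  rw [← hy n, Finset.sum_congr rfl fun j hj => by rw [treeSeq_of_mem_Ico F b hj]]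

theorem exists_solution_of_isCentral {C : Set ℕ+} (hC : IsCentral C) :
    ∃ x y : ℕ → ℕ+, (∀ n, x n ∈ C) ∧ (∀ n, y n ∈ C) ∧
      ∀ n, 2 * (x n : ℕ) + ∑ j ∈ Finset.Ico (2 ^ n) (2 ^ (n + 1)), (x j : ℕ) = y n := by
  obtain ⟨p, hpp, hpK, hCp⟩ := hC
  have hmin := leftMinimal_of_mem_smallestIdeal hpK
  obtain ⟨D, hD, hDC, K, hK⟩ := exists_uniform_hasChildren hpp hmin hCp
  obtain ⟨X, hX0, hXanti, hXp, hX⟩ := exists_antitone_hasChildren hpp hmin hD (2 ^ K)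
  have hXC : ∀ i, X i ⊆ C := fun i => (hXanti (Nat.zero_le i)).trans (hX0 ▸ hDC)
  obtain ⟨b, hb⟩ := p.nonempty_of_mem (hXp K)
  -- The truncated subtraction makes all sets from index `K` on equal to `X 0 = D`.
  obtain ⟨x, y, hx, hy, h⟩ := exists_solution_of_children (C := C) (B := fun n => X (K - n)) hb (by
    intro n x hx
    suffices h : ∃ i, HasChildren (2 ^ n) (X i) C x ∧ ∀ j, 2 ^ n ≤ j → K - j ≤ i by
      obtain ⟨i, ⟨z, hz, y, hyC, hy⟩, hi⟩ := h
      refine ⟨fun j => z (j - 2 ^ n), fun j hj =>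
        hXanti (hi j (Finset.mem_Ico.1 hj).1) (hz _), y, hyC, ?_⟩
      rw [← hy, Finset.sum_Ico_eq_sum_range]
      simp [pow_succ, mul_two]
    have hn : n < 2 ^ n := Nat.lt_two_pow_self
    rcases lt_or_ge n K with hnK | hnK
    · refine ⟨K - n - 1, ?_, fun j hj => by omega⟩
      have hk : 2 ^ n - 1 < 2 ^ K :=
        (Nat.sub_le _ _).trans_lt (Nat.pow_lt_pow_right one_lt_two hnK)
      obtain ⟨z, hz, y, hy, h⟩ := hX (K - n - 1) (2 ^ n - 1) hk x
        (by rwa [show K - n - 1 + 1 = K - n by omega])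
      rw [show 2 ^ n - 1 + 1 = 2 ^ n by omega] at h
      exact ⟨z, hz, y, hXC _ hy, h⟩
    · refine ⟨0, ?_, fun j hj => by omega⟩
      rw [Nat.sub_eq_zero_of_le hnK, hX0] at hx
      rw [hX0]
      exact hK _ (by omega) x hx)
  exact ⟨x, y, fun n => hXC _ (hx n), hy, h⟩

theorem exists_isCentral_fiber {k : ℕ} (c : ℕ+ → Fin k) : ∃ a, IsCentral {n | c n = a} := by
  obtain ⟨p, hpp, hpK⟩ := exists_idempotent_mem_smallestIdeal (S := ℕ+)
  obtain ⟨a, ha⟩ := (p.map c).eq_pure_of_finite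
  refine ⟨a, p, hpp, hpK, ?_⟩
  have : {a} ∈ p.map c := by rw [ha]; exact Set.mem_singleton a
  exact this

end PositiveIntegers

/-! ### The coefficient matrix -/

section CoefficientMatrix

theorem coeffMatrix_inl_self (n : ℕ) : coeffMatrix n (Sum.inl n) = 2 := by
  simp [coeffMatrix, matA]

theorem coeffMatrix_inl_of_mem_Ico {n j : ℕ} (hj : j ∈ Finset.Ico (2 ^ n) (2 ^ (n + 1))) :
    coeffMatrix n (Sum.inl j) = 1 := by
  have hj' := Finset.mem_Ico.1 hj
  have hn : n < 2 ^ n := Nat.lt_two_pow_self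
  have hne : j ≠ n := by omega
  simp [coeffMatrix, matA, hne, hj']

theorem coeffMatrix_inr_self (n : ℕ) : coeffMatrix n (Sum.inr n) = -1 := by
  simp [coeffMatrix]

/-- The columns in which row `n` may be nonzero. -/
def rowSupport (n : ℕ) : Finset (ℕ ⊕ ℕ) :=
  (insert n (Finset.Ico (2 ^ n) (2 ^ (n + 1)))).disjSum {n}

theorem mem_rowSupport_of_ne_zero {n : ℕ} {j : ℕ ⊕ ℕ} (h : coeffMatrix n j ≠ 0) :
    j ∈ rowSupport n := by
  rw [rowSupport]
  rcases j with j | j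
  · rw [Finset.inl_mem_disjSum, Finset.mem_insert, Finset.mem_Ico]
    contrapose! h
    simp only [coeffMatrix, Matrix.fromCols_apply_inl, matA, if_neg h.1]
    exact if_neg fun h' => absurd (h.2 h'.1) (not_le.2 h'.2)
  · rw [Finset.inr_mem_disjSum, Finset.mem_singleton]
    contrapose! h
    simp [coeffMatrix, h.symm]

theorem finsum_coeffMatrix_mul (n : ℕ) (w : ℕ ⊕ ℕ → ℚ) :
    ∑ᶠ j, coeffMatrix n j * w j = 2 * w (Sum.inl n) +
      ∑ j ∈ Finset.Ico (2 ^ n) (2 ^ (n + 1)), w (Sum.inl j) - w (Sum.inr n) := by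
  have hn : n ∉ Finset.Ico (2 ^ n) (2 ^ (n + 1)) := by
    have : n < 2 ^ n := Nat.lt_two_pow_self
    rw [Finset.mem_Ico]
    omega
  rw [finsum_eq_sum_of_support_subset (s := rowSupport n) _
    fun j hj => mem_rowSupport_of_ne_zero (left_ne_zero_of_mul hj), rowSupport,
    Finset.sum_disjSum, Finset.sum_insert hn, Finset.sum_singleton, coeffMatrix_inl_self,
    coeffMatrix_inr_self, Finset.sum_congr rfl fun j hj => by
      rw [coeffMatrix_inl_of_mem_Ico hj, one_mul]]
  ring

theorem isSolution_coeffMatrix_iff (x y : ℕ → ℕ+) :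
    IsSolution coeffMatrix (Sum.elim x y) ↔
      ∀ n : ℕ, 2 * (x n : ℕ) + ∑ j ∈ Finset.Ico (2 ^ n) (2 ^ (n + 1)), (x j : ℕ) = (y n : ℕ) := by
  refine forall_congr' fun n => ?_
  rw [finsum_coeffMatrix_mul n fun j => (((Sum.elim x y j : ℕ+) : ℕ) : ℚ), sub_eq_zero]
  simp only [Sum.elim_inl, Sum.elim_inr]
  exact_mod_cast Iff.rfl

/-- A column `inl n` in `J` would contribute `2` to row `n`, where the only negative entry is
the `-1` of the column `inr n`; without columns of the first kind, a column `inr n` in `J` leaves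
`-1` in row `n`. -/
theorem columnSum_coeffMatrix_ne_zero {J : Set (ℕ ⊕ ℕ)} (hJ : J.Nonempty) :
    columnSum coeffMatrix J ≠ 0 := by
  intro h
  let w : ℕ ⊕ ℕ → ℚ := J.indicator 1
  have hw0 : ∀ j, 0 ≤ w j := fun j => Set.indicator_nonneg (fun _ _ => zero_le_one) j
  have hw1 : ∀ j, w j ≤ 1 := fun j => Set.indicator_le_self' (fun _ _ => zero_le_one) j
  have hrow : ∀ n, 2 * w (Sum.inl n) +
      ∑ j ∈ Finset.Ico (2 ^ n) (2 ^ (n + 1)), w (Sum.inl j) - w (Sum.inr n) = 0 := by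
    intro n
    rw [← finsum_coeffMatrix_mul]
    refine Eq.trans ?_ (congrFun h n)
    rw [columnSum, finsum_mem_def]
    refine finsum_congr fun j => ?_
    by_cases hj : j ∈ J <;> simp [w, hj]
  have hmem : ∀ j ∈ J, w j = 1 := fun j hj => by simp [w, hj]
  have hinl : ∀ n, Sum.inl n ∉ J := by
    intro n hn
    have h1 := hrow n
    rw [hmem _ hn] at h1
    have h2 := hw1 (Sum.inr n)
    have h3 : 0 ≤ ∑ j ∈ Finset.Ico (2 ^ n) (2 ^ (n + 1)), w (Sum.inl j) :=
      Finset.sum_nonneg fun j _ => hw0 _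
    linarith
  obtain ⟨n | n, hn⟩ := hJ
  · exact hinl n hn
  · have h1 := hrow n
    simp [hmem _ hn, w, hinl] at h1

end CoefficientMatrix

end InfiniteRado

open InfiniteRado in
theorem theorem2p1 :
    RowFinite coeffMatrix ∧
    (∀ x y : ℕ → ℕ+, IsSolution coeffMatrix (Sum.elim x y) ↔
      ∀ n : ℕ, 2 * (x n : ℕ) + ∑ j ∈ Finset.Ico (2 ^ n) (2 ^ (n + 1)), (x j : ℕ) = (y n : ℕ)) ∧
    (∀ J : Set (ℕ ⊕ ℕ), J.Nonempty → columnSum coeffMatrix J ≠ 0) ∧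
    (∀ C : Set ℕ+, IsCentral C →
      ∃ x y : ℕ → ℕ+, (∀ n, x n ∈ C) ∧ (∀ n, y n ∈ C) ∧
        IsSolution coeffMatrix (Sum.elim x y)) ∧
    IsPartitionRegular coeffMatrix ∧
    ¬ HasColumnsProperty coeffMatrix := by
  have hcentral : ∀ C : Set ℕ+, IsCentral C →
      ∃ x y : ℕ → ℕ+, (∀ n, x n ∈ C) ∧ (∀ n, y n ∈ C) ∧
        IsSolution coeffMatrix (Sum.elim x y) := by
    intro C hC
    obtain ⟨x, y, hx, hy, h⟩ := exists_solution_of_isCentral hC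
    exact ⟨x, y, hx, hy, (isSolution_coeffMatrix_iff x y).2 h⟩
  refine ⟨fun n => (rowSupport n).finite_toSet.subset fun j hj => mem_rowSupport_of_ne_zero hj,
    isSolution_coeffMatrix_iff, fun J hJ => columnSum_coeffMatrix_ne_zero hJ, hcentral, ?_, ?_⟩
  · intro k _ c
    obtain ⟨a, ha⟩ := exists_isCentral_fiber c
    obtain ⟨x, y, hx, hy, h⟩ := hcentral _ ha
    have hmono : ∀ j, c (Sum.elim x y j) = a := by
      rintro (j | j)
      exacts [hx j, hy j]
    exact ⟨Sum.elim x y, fun j j' => (hmono j).trans (hmono j').symm, h⟩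
  · rintro ⟨μ, I, hμ, hne, -, h0, -⟩
    exact columnSum_coeffMatrix_ne_zero (hne 0 (by simpa using hμ)) h0
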